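/- **Setting.** Consider $q$ queues in discrete time. Let $\mathcal S\subset\mathbb Z_+^q$ be a set of schedules that is bounded, contains for every $j$ some $\sigma$ with $\sigma_j>0$, and is monotone ($\sigma\in\mathcal S$, $\sigma'\in\mathbb Z_+^q$, $\sigma'\le\sigma$ componentwise imply $\sigma'\in\mathcal S$). Let $\langle\mathcal S\rangle\subset\mathbb R^q$ be its convex hull, with interior $\langle\mathcal S\rangle^\circ$. The arrival vectors $a(t)\in\mathbb Z_+^q$, $t\in\mathbb Z_+$, are independent and identically distributed, bounded, with mean $\bar a$. The queue sizes satisfy $Q(t+1)=Q(t)+a(t)-d(t)\in\mathbb Z_+^q$ with $d(t)\in\mathcal S$ chosen by a policy. A *Markov policy* chooses $d(t)=\delta(Q(t),u(t))$, where $\delta(x,\cdot)\in\mathcal S$, $\delta(x,\cdot)\le x$, and $u(t)$ is a randomization variable that is independent of $a(t)$, the pairs $(a(t),u(t))$ being i.i.d. in $t$; then $Q$ is a Markov chain on $\mathbb Z_+^q$. A *MaxWeight* policy is a Markov policy for which $d(t)$ always maximizes $\sum_j Q_j(t)\sigma_j$ over $\sigma\in\mathcal S$, $\sigma\le Q(t)$,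 ties being broken arbitrarily. A state $x$ of a chain is *transient* if the chain started from $x$ returns to $x$ with probability less than $1$, *positive recurrent* if its mean return time is finite, and *essential* if every state that can be reached from $x$ leads back to $x$. As the queue chain need not be irreducible, call a chain *positive recurrent* if every essential state is positive recurrent, the mean time to reach the set of essential states is finite from every initial state, and there is a finite set of states to which the mean return time is finite from every initial state. (For an irreducible chain this says exactly that every state is positive recurrent.) **Theorem.** 1. If $\bar a\notin\langle\mathcal S\rangle$, then the queue process is transient regardless of the policy used: for every policy (history-dependent or randomized, possibly knowing $\bar a$) and every initial condition, almost surely $Q$ visits each state only finitely often; and for every Markov policy, every state of the Markov chain $Q$ is transient. 2. If $\bar a\in\langle\mathcal S\rangle^\circ$, then under every MaxWeight policy the Markov chain $Q$ is positive recurrent. -/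

import Mathlib

open MeasureTheory ProbabilityTheory
open scoped ENNReal

namespace SwitchedQueue

/-! ### Recurrence notions for a Markov chain on a discrete state space

A time-homogeneous chain is given by a family `X`, where `X x : ℕ → Ω → E` is the chain
started from the state `x`, all members living on one probability space `(Ω, P)`. -/

section Chain

/-- The state `x` is transient: started from `x`, the chain returns to `x` with probability
strictly smaller than one. -/
def IsTransientState {Ω E : Type*} [MeasurableSpace Ω] (P : Measure Ω) (X : E → ℕ → Ω → E)
    (x : E) : Prop :=
  P {ω | ∃ t, 1 ≤ t ∧ X x t ω = x} < 1

/-- The chain is transient: all its states are. -/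
def IsTransientChain {Ω E : Type*} [MeasurableSpace Ω] (P : Measure Ω) (X : E → ℕ → Ω → E) :
    Prop :=
  ∀ x, IsTransientState P X x

/-- `𝔼[inf {t ≥ n : Y t ∈ A}]`, with the infimum of the empty set equal to `∞`. -/
noncomputable def expectedHittingAfter {Ω E : Type*} [MeasurableSpace Ω] (P : Measure Ω)
    (Y : ℕ → Ω → E) (A : Set E) (n : ℕ) : ℝ≥0∞ :=
  ∫⁻ ω, ENat.toENNReal (hittingAfter Y A n ω) ∂P

/-- The state `x` is positive recurrent: the mean return time to `x` is finite. -/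
def IsPositiveRecurrentState {Ω E : Type*} [MeasurableSpace Ω] (P : Measure Ω)
    (X : E → ℕ → Ω → E) (x : E) : Prop :=
  expectedHittingAfter P (X x) {x} 1 < ∞

/-- The chain started from `x` visits `y` with positive probability. -/
def LeadsTo {Ω E : Type*} [MeasurableSpace Ω] (P : Measure Ω) (X : E → ℕ → Ω → E)
    (x y : E) : Prop :=
  ∃ t, 0 < P {ω | X x t ω = y}

/-- `x` is an essential state: every state to which `x` leads leads back to `x`. Equivalently,
the communicating class of `x` is closed. In an irreducible chain all states are essential. -/
def IsEssential {Ω E : Type*} [MeasurableSpace Ω] (P : Measure Ω) (X : E → ℕ → Ω → E)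
    (x : E) : Prop :=
  ∀ y, LeadsTo P X x y → LeadsTo P X y x

/-- Positive recurrence of a chain that need not be irreducible. For an irreducible chain this
says exactly that every state is positive recurrent. -/
structure IsPositiveRecurrentChain {Ω E : Type*} [MeasurableSpace Ω] (P : Measure Ω)
    (X : E → ℕ → Ω → E) : Prop where
  /-- all states of closed communicating classes are positive recurrent -/
  essential : ∀ x, IsEssential P X x → IsPositiveRecurrentState P X x
  /-- from every initial state, the mean time to enter the closed classes is finite -/
  absorbed : ∀ x, expectedHittingAfter P (X x) {y | IsEssential P X y} 0 < ∞
  /-- some finite set of states is positive recurrent -/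
  finite_set : ∃ F : Set E, F.Finite ∧ ∀ x, expectedHittingAfter P (X x) F 1 < ∞

end Chain

/-! ### The switched queueing network -/

section Network

/-- A set of schedules: bounded, able to serve every queue, and closed under passing to
componentwise smaller vectors. -/
structure IsScheduleSet {q : ℕ} (S : Set (Fin q → ℕ)) : Prop where
  bounded : ∃ dmax : ℕ, ∀ σ ∈ S, ∀ j, σ j ≤ dmax
  served : ∀ j, ∃ σ ∈ S, 0 < σ j
  monotone : ∀ σ ∈ S, ∀ σ' : Fin q → ℕ, σ' ≤ σ → σ' ∈ S

/-- The convex hull `⟨S⟩` of the schedules in `ℝ^q`. -/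
def stabilityRegion {q : ℕ} (S : Set (Fin q → ℕ)) : Set (Fin q → ℝ) :=
  convexHull ℝ ((fun (σ : Fin q → ℕ) (j : Fin q) => (σ j : ℝ)) '' S)

/-- The random input of the network: i.i.d. bounded arrival vectors `a t` with mean `abar`, and
variables `u t` available to the scheduler for randomization (for instance, for breaking ties).
The pairs `(a t, u t)` are i.i.d. over time and `u t` is independent of `a t`. -/
structure IsInput {q : ℕ} {Ω U : Type*} [MeasurableSpace Ω] [MeasurableSpace U]
    (P : Measure Ω) (a : ℕ → Ω → Fin q → ℕ) (u : ℕ → Ω → U) (abar : Fin q → ℝ) : Prop where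
  measurable_arrival : ∀ t, Measurable (a t)
  measurable_random : ∀ t, Measurable (u t)
  indep : iIndepFun (fun t ω => (a t ω, u t ω)) P
  ident : ∀ t, IdentDistrib (fun ω => (a t ω, u t ω)) (fun ω => (a 0 ω, u 0 ω)) P P
  indep_random : ∀ t, IndepFun (a t) (u t) P
  bounded : ∃ amax : ℕ, ∀ t, ∀ᵐ ω ∂P, ∀ j, a t ω j ≤ amax
  mean : ∀ t j, ∫ ω, (a t ω j : ℝ) ∂P = abar j

/-- `Q` is the queue size process that results from the arrivals `a` and the departures `d`,
where `d` is produced by any policy whatsoever: `d t ω` is a schedule, and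
`Q (t + 1) = Q t + a t - d t` (written without subtraction, so that `Q` stays nonnegative).
The decisions may depend on the whole history, on `abar` and on extra randomness, and the initial
queue sizes `Q 0` may be random. -/
structure IsQueueProcess {q : ℕ} {Ω : Type*} (S : Set (Fin q → ℕ))
    (a d Q : ℕ → Ω → Fin q → ℕ) : Prop where
  schedule : ∀ t ω, d t ω ∈ S
  dynamics : ∀ t ω, Q (t + 1) ω + d t ω = Q t ω + a t ω

/-- A stationary Markov policy, possibly randomized: in queue state `x` with randomization
variable `v`, the departure vector is `δ x v`, a schedule that is at most `x`. -/
structure IsMarkovPolicy {q : ℕ} {U : Type*} [MeasurableSpace U] (S : Set (Fin q → ℕ))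
    (δ : (Fin q → ℕ) → U → Fin q → ℕ) : Prop where
  measurable : ∀ x, Measurable (δ x)
  schedule : ∀ x v, δ x v ∈ S
  le_queue : ∀ x v, δ x v ≤ x

/-- A MaxWeight policy: `δ x v` maximizes `∑ j, x j * σ j` over the schedules `σ ≤ x`. Ties are
broken arbitrarily, possibly at random. -/
structure IsMaxWeight {q : ℕ} {U : Type*} [MeasurableSpace U] (S : Set (Fin q → ℕ))
    (δ : (Fin q → ℕ) → U → Fin q → ℕ) : Prop extends IsMarkovPolicy S δ where
  maximal : ∀ x v, ∀ σ ∈ S, σ ≤ x → ∑ j, x j * σ j ≤ ∑ j, x j * δ x v j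

/-- The queue size process started from `x` under the policy `δ`. The subtraction is exact when
`δ` is a Markov policy, since then `δ x v ≤ x`. -/
def queue {q : ℕ} {Ω U : Type*} (δ : (Fin q → ℕ) → U → Fin q → ℕ)
    (a : ℕ → Ω → Fin q → ℕ) (u : ℕ → Ω → U) (x : Fin q → ℕ) : ℕ → Ω → Fin q → ℕ
  | 0, _ => x
  | t + 1, ω => queue δ a u x t ω + a t ω - δ (queue δ a u x t ω) (u t ω)

end Network

end SwitchedQueue

/-! Outside the stability region: `S` is finite, so its convex hull is closed and some linear
functional `φ` satisfies `φ < c < c' < φ abar` for all values of `φ` on the hull. Every departure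
vector lowers `φ` of the queue by less than `c`, whatever the policy, while by the strong law the
arrivals eventually raise it by at least `c'` per step on average. Hence `φ (Q n)` tends to infinity
and no state recurs infinitely often (`IsQueueProcess.finite_visits`). For a Markov policy, a state
with sure return would be visited infinitely often, so every state is transient. Inside the region:
take the Lyapunov function `∑ j, x j ^ 2`. Up to a constant, MaxWeight serves at least the weight of
any point of the hull (`IsMaxWeight.sum_mul_le`), in particular of `abar + ε`. The mean drift is
therefore at most `K - 2 * ε * ∑ j, x j`, which is below `-1` off a finite set, and Foster's
criterion applies. Without irreducibility the criterion is derived from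
`expectedHittingAfter_lt_top`, used with three different target sets. -/

namespace SwitchedQueue

/-! ### Hitting times, communication and Foster's criterion for Markov families. -/

section MarkovFamily

variable {Ω E : Type*} [MeasurableSpace Ω] [MeasurableSpace E]

/-- The chains `X x`, started from the states `x`, have the Markov property at time `1`, with
transition probabilities that do not change in time. -/
structure IsMarkovFamily (P : Measure Ω) (X : E → ℕ → Ω → E) : Prop where
  start : ∀ x ω, X x 0 ω = x
  measurable : ∀ x t, Measurable (X x t)
  first_step : ∀ x (B : Set (ℕ → E)), MeasurableSet B →
    P {ω | (fun t => X x (t + 1) ω) ∈ B} =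
      ∫⁻ ω, P {ω' | (fun t => X (X x 1 ω) t ω') ∈ B} ∂P

/-- The probability that the chain started from `x` avoids `A` up to time `n`. -/
noncomputable def survival (P : Measure Ω) (X : E → ℕ → Ω → E) (A : Set E) (n : ℕ) (x : E) :
    ℝ≥0∞ :=
  P {ω | ∀ k ≤ n, X x k ω ∉ A}

theorem survival_of_mem {P : Measure Ω} {X : E → ℕ → Ω → E} (hX : IsMarkovFamily P X) {A : Set E}
    {x : E} (hx : x ∈ A) (n : ℕ) : survival P X A n x = 0 := by
  have : {ω | ∀ k ≤ n, X x k ω ∉ A} = ∅ := by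
    ext ω
    simp only [Set.mem_ofPred_eq, Set.mem_empty_iff_false, iff_false]
    intro h
    exact h 0 (Nat.zero_le _) (by rwa [hX.start])
  rw [survival, this, measure_empty]

theorem survival_zero_of_notMem {P : Measure Ω} [IsProbabilityMeasure P] {X : E → ℕ → Ω → E}
    (hX : IsMarkovFamily P X) {A : Set E} {x : E} (hx : x ∉ A) : survival P X A 0 x = 1 := by
  have : {ω | ∀ k ≤ 0, X x k ω ∉ A} = Set.univ := by
    ext ω
    simp [hX.start, hx]
  rw [survival, this, measure_univ]

omit [MeasurableSpace E] in
theorem survival_le_one {P : Measure Ω} [IsProbabilityMeasure P] (X : E → ℕ → Ω → E) (A : Set E)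
    (n : ℕ) (x : E) : survival P X A n x ≤ 1 :=
  prob_le_one

omit [MeasurableSpace E] in
theorem survival_antitone (P : Measure Ω) (X : E → ℕ → Ω → E) (A : Set E) (x : E) :
    Antitone fun n => survival P X A n x := fun _ _ hmn =>
  measure_mono fun _ h k hk => h k (hk.trans hmn)

variable [Countable E] [MeasurableSingletonClass E]

theorem measurableSet_avoid (A : Set E) (n : ℕ) :
    MeasurableSet {y : ℕ → E | ∀ k ≤ n, y k ∉ A} := by
  simp only [Set.ofPred_forall]
  exact MeasurableSet.iInter fun k => MeasurableSet.iInter fun _ =>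
    (measurable_pi_apply (X := fun _ : ℕ => E) k) A.to_countable.measurableSet.compl

theorem measure_avoid_succ {P : Measure Ω} {X : E → ℕ → Ω → E} (hX : IsMarkovFamily P X)
    (A : Set E) (n : ℕ) (x : E) :
    P {ω | ∀ k ≤ n, X x (k + 1) ω ∉ A} = ∫⁻ ω, survival P X A n (X x 1 ω) ∂P :=
  hX.first_step x _ (measurableSet_avoid A n)

theorem survival_succ {P : Measure Ω} {X : E → ℕ → Ω → E} (hX : IsMarkovFamily P X)
    {A : Set E} {x : E} (hx : x ∉ A) (n : ℕ) :
    survival P X A (n + 1) x = ∫⁻ ω, survival P X A n (X x 1 ω) ∂P := by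
  rw [← measure_avoid_succ hX, survival]
  congr 1
  ext ω
  simp only [Set.mem_ofPred_eq]
  constructor
  · exact fun h k hk => h (k + 1) (by omega)
  · rintro h (_ | k) hk
    · rwa [hX.start]
    · exact h k (by omega)

theorem measurable_comp_step {P : Measure Ω} {X : E → ℕ → Ω → E} (hX : IsMarkovFamily P X)
    (g : E → ℝ≥0∞) (x : E) (t : ℕ) : Measurable fun ω => g (X x t ω) :=
  (measurable_of_countable g).comp (hX.measurable x t)

/-- A nonnegative function that decreases by at least `1` in the mean outside `A` bounds the mean
time spent before `A`. -/
theorem tsum_survival_le {P : Measure Ω} [IsProbabilityMeasure P] {X : E → ℕ → Ω → E}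
    (hX : IsMarkovFamily P X) {A : Set E} {W : E → ℝ≥0∞}
    (hW : ∀ x ∉ A, ∫⁻ ω, W (X x 1 ω) ∂P + 1 ≤ W x) (x : E) :
    ∑' n, survival P X A n x ≤ W x := by
  have key : ∀ (N : ℕ) (x : E), ∑ n ∈ Finset.range N, survival P X A n x ≤ W x := by
    intro N
    induction N with
    | zero => simp
    | succ N ih =>
      intro x
      by_cases hx : x ∈ A
      · simp [survival_of_mem hX hx]
      · rw [Finset.sum_range_succ', survival_zero_of_notMem hX hx]
        simp only [survival_succ hX hx]
        rw [← lintegral_finsetSum _ fun n _ => measurable_comp_step hX _ x 1]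
        refine le_trans ?_ (hW x hx)
        gcongr
        exact ih _
  exact ENNReal.tsum_le_of_sum_range_le fun N => key N x

-- Pointwise tail-sum formula: the waiting time after `m` counts the `n` for which `A` is avoided
-- throughout `[m, m + n]`. If `A` is never hit, both sides are infinite.
omit [MeasurableSpace Ω] [MeasurableSpace E] [Countable E] [MeasurableSingletonClass E] in
theorem toENNReal_hittingAfter {Y : ℕ → Ω → E} {A : Set E} (m : ℕ) (ω : Ω) :
    ENat.toENNReal (hittingAfter Y A m ω) =
      m + ∑' n, Set.indicator {ω | ∀ k ≤ n, Y (k + m) ω ∉ A} 1 ω := by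
  classical
  by_cases h : ∃ j, m ≤ j ∧ Y j ω ∈ A
  · have hd : ∃ d, Y (d + m) ω ∈ A := by
      obtain ⟨j, hj, hjA⟩ := h
      exact ⟨j - m, by rwa [Nat.sub_add_cancel hj]⟩
    have hit : hittingAfter Y A m ω = ((Nat.find hd + m : ℕ) : ℕ∞) := by
      have hs : sInf {i : ℕ | m ≤ i ∧ Y i ω ∈ A} = Nat.find hd + m := by
        refine IsLeast.csInf_eq ⟨⟨Nat.le_add_left _ _, Nat.find_spec hd⟩, ?_⟩
        rintro i ⟨hi, hiA⟩
        have := Nat.find_min' hd (m := i - m) (by rwa [Nat.sub_add_cancel hi])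
        omega
      rw [hittingAfter, if_pos h, hs]
      rfl
    rw [hit, tsum_eq_sum (s := Finset.range (Nat.find hd))]
    · rw [Finset.sum_congr rfl (g := fun _ => 1)]
      · simp [add_comm]
      · intro n hn
        refine Set.indicator_of_mem ?_ _
        intro k hk
        exact Nat.find_min hd (hk.trans_lt (Finset.mem_range.1 hn))
    · intro n hn
      refine Set.indicator_of_notMem ?_ _
      intro hmem
      exact hmem _ (by simpa using hn) (Nat.find_spec hd)
  · push Not at h
    rw [hittingAfter_eq_top_iff.2 h]
    have h1 : ∀ n, Set.indicator {ω | ∀ k ≤ n, Y (k + m) ω ∉ A} (1 : Ω → ℝ≥0∞) ω = 1 := fun n =>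
      by
      refine Set.indicator_of_mem ?_ _
      exact fun k _ => h _ (Nat.le_add_left _ _)
    rw [show ENat.toENNReal (⊤ : WithTop ℕ) = ∞ from ENat.toENNReal_top]
    simp [h1]

theorem expectedHittingAfter_eq {P : Measure Ω} [IsProbabilityMeasure P] {Y : ℕ → Ω → E}
    (hY : ∀ t, Measurable (Y t)) (A : Set E) (m : ℕ) :
    expectedHittingAfter P Y A m = m + ∑' n, P {ω | ∀ k ≤ n, Y (k + m) ω ∉ A} := by
  have hm : ∀ n, MeasurableSet {ω | ∀ k ≤ n, Y (k + m) ω ∉ A} := by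
    intro n
    simp only [Set.ofPred_forall]
    exact MeasurableSet.iInter fun k => MeasurableSet.iInter fun _ =>
      hY _ A.to_countable.measurableSet.compl
  simp only [expectedHittingAfter, toENNReal_hittingAfter]
  rw [lintegral_add_left measurable_const, lintegral_const, measure_univ, mul_one,
    lintegral_tsum fun n => (measurable_one.indicator (hm n)).aemeasurable]
  simp only [lintegral_indicator_one (hm _)]

theorem expectedHittingAfter_zero {P : Measure Ω} [IsProbabilityMeasure P] {X : E → ℕ → Ω → E}
    (hX : IsMarkovFamily P X) (A : Set E) (x : E) :
    expectedHittingAfter P (X x) A 0 = ∑' n, survival P X A n x := by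
  simp [expectedHittingAfter_eq (hX.measurable x), survival]

theorem expectedHittingAfter_one {P : Measure Ω} [IsProbabilityMeasure P] {X : E → ℕ → Ω → E}
    (hX : IsMarkovFamily P X) (A : Set E) (x : E) :
    expectedHittingAfter P (X x) A 1 =
      1 + ∫⁻ ω, ∑' n, survival P X A n (X x 1 ω) ∂P := by
  rw [expectedHittingAfter_eq (hX.measurable x),
    lintegral_tsum fun n => (measurable_comp_step hX _ x 1).aemeasurable]
  simp only [measure_avoid_succ hX, Nat.cast_one]

/-! ### Communication -/

omit [Countable E] [MeasurableSingletonClass E] in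
theorem LeadsTo.refl {P : Measure Ω} [IsProbabilityMeasure P] {X : E → ℕ → Ω → E}
    (hX : IsMarkovFamily P X) (x : E) : LeadsTo P X x x :=
  ⟨0, by simp [hX.start]⟩

omit [Countable E] in
theorem measure_eq_succ {P : Measure Ω} {X : E → ℕ → Ω → E}
    (hX : IsMarkovFamily P X) (x y : E) (t : ℕ) :
    P {ω | X x (t + 1) ω = y} = ∫⁻ ω, P {ω' | X (X x 1 ω) t ω' = y} ∂P :=
  hX.first_step x {z | z t = y} 
    ((measurable_pi_apply (X := fun _ : ℕ => E) t) (measurableSet_singleton y))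

/-- One of the paths from `x` to `w` passes through `y` at time `s`. Since the Markov property is
available at time `1` only, the induction peels off first steps with `x` general. -/
theorem mul_le_measure_add {P : Measure Ω} [IsProbabilityMeasure P] {X : E → ℕ → Ω → E}
    (hX : IsMarkovFamily P X) (s t : ℕ) (x y w : E) :
    P {ω | X x s ω = y} * P {ω | X y t ω = w} ≤ P {ω | X x (s + t) ω = w} := by
  induction s generalizing x with
  | zero =>
    by_cases h : x = y
    · subst h
      rw [Nat.zero_add]
      exact mul_le_of_le_one_left' prob_le_one
    · simp [hX.start, h]
  | succ s ih =>
    rw [Nat.add_right_comm, measure_eq_succ hX, measure_eq_succ hX,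
      ← lintegral_mul_const _ (measurable_comp_step hX (fun v => P {ω' | X v s ω' = y}) x 1)]
    exact lintegral_mono fun ω => ih _

theorem LeadsTo.trans {P : Measure Ω} [IsProbabilityMeasure P] {X : E → ℕ → Ω → E}
    (hX : IsMarkovFamily P X) {x y w : E} (h₁ : LeadsTo P X x y) (h₂ : LeadsTo P X y w) :
    LeadsTo P X x w := by
  obtain ⟨s, hs⟩ := h₁
  obtain ⟨t, ht⟩ := h₂
  exact ⟨s + t, (ENNReal.mul_pos hs.ne' ht.ne').trans_le (mul_le_measure_add hX s t x y w)⟩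

/-- A set that is reached in finite mean time contains a state that can be reached. -/
theorem exists_leadsTo_of_expectedHittingAfter_lt_top {P : Measure Ω} [IsProbabilityMeasure P]
    {X : E → ℕ → Ω → E} (hX : IsMarkovFamily P X) {A : Set E} {x : E} {n : ℕ}
    (h : expectedHittingAfter P (X x) A n < ∞) : ∃ y ∈ A, LeadsTo P X x y := by
  by_contra! hA
  have h0 : ∀ t, P {ω | X x t ω ∈ A} = 0 := by
    intro t
    have : {ω | X x t ω ∈ A} = ⋃ y ∈ A, {ω | X x t ω = y} := by ext ω; simp
    rw [this, measure_biUnion_null_iff A.to_countable]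
    intro y hy
    by_contra hne
    exact hA y hy ⟨t, pos_iff_ne_zero.2 hne⟩
  have h1 : ∀ k, P {ω | ∀ j ≤ k, X x (j + n) ω ∉ A} = 1 := by
    intro k
    have hae : ∀ᵐ ω ∂P, ∀ t, X x t ω ∉ A := by
      rw [ae_all_iff]
      intro t
      rw [ae_iff]
      simpa using h0 t
    rw [← measure_univ (μ := P)]
    refine measure_congr ?_
    filter_upwards [hae] with ω hω
    refine propext ?_
    change (∀ j ≤ k, X x (j + n) ω ∉ A) ↔ True
    simp [hω]
  rw [expectedHittingAfter_eq (hX.measurable x)] at h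
  simp [h1] at h

/-! ### Foster's criterion -/

-- Being in `A` at time `t` is disjoint from avoiding `A` up to `t`. Finiteness of `F` makes the
-- time and the probability uniform, by a maximum and a minimum.
omit [Countable E] in
theorem exists_survival_add_le_one {P : Measure Ω} [IsProbabilityMeasure P] {X : E → ℕ → Ω → E}
    (hX : IsMarkovFamily P X) {A F : Set E} (hF : F.Finite)
    (hFA : ∀ y ∈ F, ∃ z ∈ A, LeadsTo P X y z) :
    ∃ N : ℕ, ∃ p : ℝ≥0∞, p ≠ 0 ∧ p ≤ 1 ∧ ∀ y ∈ F, survival P X A N y + p ≤ 1 := by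
  induction F, hF using Set.Finite.induction_on with
  | empty => exact ⟨0, 1, one_ne_zero, le_rfl, by simp⟩
  | @insert a F _ _ ih =>
    obtain ⟨N, p, hp0, hp1, hp⟩ := ih fun y hy => hFA y (Set.mem_insert_of_mem _ hy)
    obtain ⟨z, hz, t, ht⟩ := hFA a (Set.mem_insert _ _)
    refine ⟨max N t, min p (P {ω | X a t ω = z}), ?_, (min_le_left _ _).trans hp1, ?_⟩
    · exact (lt_min (pos_iff_ne_zero.2 hp0) ht).ne'
    · rintro y (rfl | hy)
      · calc _ ≤ survival P X A t y + P {ω | X y t ω = z} := by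
              gcongr
              · exact survival_antitone P X A y (le_max_right _ _)
              · exact min_le_right _ _
          _ = P ({ω | ∀ k ≤ t, X y k ω ∉ A} ∪ {ω | X y t ω = z}) := by
              refine (measure_union ?_ (hX.measurable y t (measurableSet_singleton z))).symm
              rw [Set.disjoint_left]
              intro ω h1 h2
              exact h1 t le_rfl (by rw [show X y t ω = z from h2]; exact hz)
          _ ≤ 1 := prob_le_one
      · refine le_trans ?_ (hp y hy)
        gcongr
        · exact survival_antitone P X A y (le_max_left _ _)
        · exact min_le_left _ _

/-- If a Lyapunov function decreases in the mean outside the finite set `F`, and `A` can be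
reached from every state of `F`, then `A` is reached in finite mean time from everywhere. -/
theorem expectedHittingAfter_lt_top {P : Measure Ω} [IsProbabilityMeasure P] {X : E → ℕ → Ω → E}
    (hX : IsMarkovFamily P X) {F : Set E} (hF : F.Finite) {V : E → ℝ≥0∞} (hVtop : ∀ x, V x ≠ ∞)
    {b : ℝ≥0∞} (hb : b ≠ ∞)
    (hV : ∀ x, ∫⁻ ω, V (X x 1 ω) ∂P + 1 ≤ V x + F.indicator (fun _ => b) x) {A : Set E}
    (hFA : ∀ y ∈ F, ∃ z ∈ A, LeadsTo P X y z) (x : E) :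
    expectedHittingAfter P (X x) A 0 < ∞ ∧ expectedHittingAfter P (X x) A 1 < ∞ := by
  obtain ⟨N, p, hp0, hp1, hp⟩ := exists_survival_add_le_one hX hF hFA
  have hptop : p ≠ ∞ := ne_top_of_le_ne_top ENNReal.one_ne_top hp1
  -- `G` is the mean time before `A`, truncated at `N`. Off `A` its mean never increases, and on `F`
  -- it drops by at least `p`. With `c * p = b`, adding `c * G` to `V` pays for the excess `b` on
  -- `F`.
  set G : E → ℝ≥0∞ := fun y => ∑ n ∈ Finset.range N, survival P X A n y with hG
  set c : ℝ≥0∞ := b / p with hc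
  have hctop : c ≠ ∞ := ENNReal.div_ne_top hb hp0
  have hcp : c * p = b := ENNReal.div_mul_cancel hp0 hptop
  have hGN : ∀ y, G y ≤ N := fun y => by
    simpa using Finset.sum_le_card_nsmul (Finset.range N) (fun n => survival P X A n y) 1
      fun n _ => survival_le_one X A n y
  have hGtop : ∀ y, G y ≠ ∞ := fun y => ne_top_of_le_ne_top (ENNReal.natCast_ne_top N) (hGN y)
  have hTG : ∀ y ∉ A, ∫⁻ ω, G (X y 1 ω) ∂P + 1 = G y + survival P X A N y := by
    intro y hy
    rw [← Finset.sum_range_succ, Finset.sum_range_succ', survival_zero_of_notMem hX hy]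
    simp only [hG, survival_succ hX hy]
    rw [← lintegral_finsetSum _ fun n _ => measurable_comp_step hX _ y 1]
  have hG1 : ∀ y ∉ A, ∫⁻ ω, G (X y 1 ω) ∂P ≤ G y := fun y hy => by
    rw [← ENNReal.add_le_add_iff_right ENNReal.one_ne_top, hTG y hy]
    gcongr
    exact survival_le_one X A N y
  have hG2 : ∀ y ∉ A, y ∈ F → ∫⁻ ω, G (X y 1 ω) ∂P + p ≤ G y := fun y hy hyF => by
    rw [← ENNReal.add_le_add_iff_right ENNReal.one_ne_top, add_right_comm, hTG y hy, add_assoc]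
    gcongr
    exact hp y hyF
  set W : E → ℝ≥0∞ := fun y => V y + c * G y with hWdef
  have hTW : ∀ y, ∫⁻ ω, W (X y 1 ω) ∂P =
      ∫⁻ ω, V (X y 1 ω) ∂P + c * ∫⁻ ω, G (X y 1 ω) ∂P := fun y => by
    simp only [hWdef]
    rw [lintegral_add_left (measurable_comp_step hX V y 1),
      lintegral_const_mul _ (measurable_comp_step hX G y 1)]
  have hW : ∀ y ∉ A, ∫⁻ ω, W (X y 1 ω) ∂P + 1 ≤ W y := by
    intro y hy
    rw [hTW, add_right_comm]
    by_cases hyF : y ∈ F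
    · calc _ ≤ V y + b + c * ∫⁻ ω, G (X y 1 ω) ∂P :=
            add_le_add ((hV y).trans_eq (by simp [hyF])) le_rfl
        _ = V y + c * (∫⁻ ω, G (X y 1 ω) ∂P + p) := by rw [← hcp]; ring
        _ ≤ W y := by
            simp only [hWdef]
            gcongr
            exact hG2 y hy hyF
    · exact add_le_add ((hV y).trans_eq (by simp [hyF])) (mul_le_mul_right (hG1 y hy) c)
  have hsum := tsum_survival_le hX hW
  constructor
  · rw [expectedHittingAfter_zero hX]
    exact (hsum x).trans_lt (ENNReal.add_lt_top.2
      ⟨(hVtop x).lt_top, ENNReal.mul_lt_top hctop.lt_top (hGtop x).lt_top⟩)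
  · rw [expectedHittingAfter_one hX]
    refine ENNReal.add_lt_top.2 ⟨ENNReal.one_lt_top, ?_⟩
    refine (lintegral_mono fun ω => hsum (X x 1 ω)).trans_lt ?_
    rw [hTW]
    refine ENNReal.add_lt_top.2 ⟨?_, ENNReal.mul_lt_top hctop.lt_top ?_⟩
    · refine (le_self_add.trans (hV x)).trans_lt (ENNReal.add_lt_top.2 ⟨(hVtop x).lt_top, ?_⟩)
      by_cases hxF : x ∈ F <;> simp [hxF, hb.lt_top]
    · calc _ ≤ ∫⁻ _, (N : ℝ≥0∞) ∂P := lintegral_mono fun ω => hGN _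
        _ < ∞ := by simp

/-- Foster's criterion for chains that need not be irreducible. -/
theorem isPositiveRecurrentChain_of_drift {P : Measure Ω} [IsProbabilityMeasure P]
    {X : E → ℕ → Ω → E} (hX : IsMarkovFamily P X) {F : Set E} (hF : F.Finite) {V : E → ℝ≥0∞}
    (hVtop : ∀ x, V x ≠ ∞) {b : ℝ≥0∞} (hb : b ≠ ∞)
    (hV : ∀ x, ∫⁻ ω, V (X x 1 ω) ∂P + 1 ≤ V x + F.indicator (fun _ => b) x) :
    IsPositiveRecurrentChain P X := by
  have hFall : ∀ x, expectedHittingAfter P (X x) F 1 < ∞ := fun x =>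
    (expectedHittingAfter_lt_top hX hF hVtop hb hV
      (fun y hy => ⟨y, hy, LeadsTo.refl hX y⟩) x).2
  refine ⟨fun x hx => ?_, fun x => ?_, F, hF, hFall⟩
  -- This target is reachable from every `y`: if `x` leads to `y`, essentiality leads back to `x`;
  -- otherwise `y` itself lies in `A`. Started from `x`, the chain almost surely never meets the
  -- unreachable states, so hitting `A` amounts to returning to `x`.
  · set A : Set E := {y | y = x ∨ ¬ LeadsTo P X x y} with hA
    have hfin := (expectedHittingAfter_lt_top hX hF hVtop hb hV (A := A) (fun y _ => by
      by_cases hy : LeadsTo P X x y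
      · exact ⟨x, Or.inl rfl, hx y hy⟩
      · exact ⟨y, Or.inr hy, LeadsTo.refl hX y⟩) x).2
    rw [IsPositiveRecurrentState]
    rw [expectedHittingAfter_eq (hX.measurable x)] at hfin ⊢
    convert hfin using 4 with n
    refine measure_congr ?_
    have hae : ∀ᵐ ω ∂P, ∀ t, LeadsTo P X x (X x t ω) := by
      rw [ae_all_iff]
      intro t
      have : {ω | ¬ LeadsTo P X x (X x t ω)} =
          ⋃ y ∈ {y | ¬ LeadsTo P X x y}, {ω | X x t ω = y} := by ext ω; simp
      rw [ae_iff, this, measure_biUnion_null_iff (Set.to_countable _)]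
      intro y hy
      by_contra hne
      exact hy ⟨t, pos_iff_ne_zero.2 hne⟩
    filter_upwards [hae] with ω hω
    refine propext ?_
    change (∀ k ≤ n, X x (k + 1) ω ∉ ({x} : Set E)) ↔ ∀ k ≤ n, X x (k + 1) ω ∉ A
    simp [hA, hω]
  · refine (expectedHittingAfter_lt_top hX hF hVtop hb hV (fun y _ => ?_) x).1
    have hlead : ∀ w, ∃ v ∈ F, LeadsTo P X w v := fun w =>
      exists_leadsTo_of_expectedHittingAfter_lt_top hX (hFall w)
    have hR : ∀ w, (F ∩ {v | LeadsTo P X w v}).Finite := fun w => hF.inter_of_left _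
    obtain ⟨v, hvF, hyv⟩ := hlead y
    -- A state of `F` that reaches the fewest states of `F` is essential: any `w` it leads to
    -- reaches some `f ∈ F`, and by minimality `f` reaches as much of `F` as `z` does, including
    -- `z`.
    obtain ⟨z, hz, hmin⟩ := Set.exists_min_image (F ∩ {v | LeadsTo P X y v})
      (fun w => (F ∩ {v | LeadsTo P X w v}).ncard) (hR y) ⟨v, hvF, hyv⟩
    refine ⟨z, fun w hzw => ?_, hz.2⟩
    obtain ⟨f, hfF, hwf⟩ := hlead w
    have hzf := hzw.trans hX hwf
    have heq := Set.eq_of_subset_of_ncard_le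
      (s := F ∩ {v | LeadsTo P X f v}) (t := F ∩ {v | LeadsTo P X z v})
      (fun u hu => ⟨hu.1, hzf.trans hX hu.2⟩) (hmin f ⟨hfF, LeadsTo.trans hX hz.2 hzf⟩) (hR z)
    have hzmem : z ∈ F ∩ {v | LeadsTo P X f v} := heq ▸ ⟨hz.1, LeadsTo.refl hX z⟩
    exact hwf.trans hX hzmem.2

end MarkovFamily
-- Chains driven by i.i.d. inputs.
section Drive

variable {Ω E Z : Type*} [MeasurableSpace Ω] [MeasurableSpace E] [MeasurableSpace Z]

/-- The orbit of `x` under the maps `f · (ζ 0)`, `f · (ζ 1)`, … -/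
def drive (f : E → Z → E) (x : E) (ζ : ℕ → Z) : ℕ → E
  | 0 => x
  | t + 1 => f (drive f x ζ t) (ζ t)

omit [MeasurableSpace E] [MeasurableSpace Z] in
theorem drive_succ' (f : E → Z → E) (x : E) (ζ : ℕ → Z) (t : ℕ) :
    drive f x ζ (t + 1) = drive f (f x (ζ 0)) (fun s => ζ (s + 1)) t := by
  induction t with
  | zero => rfl
  | succ t ih => rw [drive, ih]; rfl

theorem indepFun_head_tail {P : Measure Ω} {z : ℕ → Ω → Z} (hz : ∀ t, Measurable (z t))
    (hind : iIndepFun z P) : IndepFun (z 0) (fun ω t => z (t + 1) ω) P := by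
  rw [IndepFun_iff_Indep]
  have h := indep_iSup_of_disjoint (fun t => (hz t).comap_le) hind.iIndep
    (S := {0}) (T := Set.Ioi 0) (by simp)
  refine indep_of_indep_of_le_left (indep_of_indep_of_le_right h ?_) ?_
  · rw [MeasurableSpace.pi, MeasurableSpace.comap_iSup]
    refine iSup_le fun t => ?_
    rw [MeasurableSpace.comap_comp]
    exact le_iSup₂_of_le (t + 1) (Nat.succ_pos t) le_rfl
  · exact le_iSup₂_of_le 0 rfl le_rfl

theorem map_tail_eq {P : Measure Ω} [IsProbabilityMeasure P] {z : ℕ → Ω → Z}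
    (hz : ∀ t, Measurable (z t)) (hind : iIndepFun z P) (hid : ∀ t, IdentDistrib (z t) (z 0) P P) :
    P.map (fun ω t => z (t + 1) ω) = P.map (fun ω t => z t ω) := by
  rw [(hind.precomp (add_left_injective 1)).map_fun_eq_infinitePi_map (fun t => hz (t + 1)),
    hind.map_fun_eq_infinitePi_map hz]
  congr 1
  funext t
  rw [(hid (t + 1)).map_eq, (hid t).map_eq]

variable [Countable E] [MeasurableSingletonClass E]

theorem measurable_drive {f : E → Z → E} (hf : ∀ x, Measurable (f x)) (x : E) :
    Measurable (drive f x) := by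
  refine measurable_pi_lambda _ fun t => ?_
  induction t with
  | zero => exact measurable_const
  | succ t ih =>
    have hf' : Measurable fun p : E × Z => f p.1 p.2 := measurable_from_prod_countable_right hf
    exact hf'.comp (ih.prodMk (measurable_pi_apply t))

/-- A chain driven by i.i.d. inputs has the Markov property. -/
theorem isMarkovFamily_drive {P : Measure Ω} [IsProbabilityMeasure P] {f : E → Z → E}
    (hf : ∀ x, Measurable (f x)) {z : ℕ → Ω → Z} (hz : ∀ t, Measurable (z t))
    (hind : iIndepFun z P) (hid : ∀ t, IdentDistrib (z t) (z 0) P P) :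
    IsMarkovFamily P fun x t ω => drive f x (fun s => z s ω) t := by
  have hZ : Measurable fun ω s => z s ω := measurable_pi_lambda _ hz
  have hT : Measurable fun ω s => z (s + 1) ω := measurable_pi_lambda _ fun s => hz (s + 1)
  refine ⟨fun x ω => rfl,
    fun x t => (measurable_pi_apply t).comp ((measurable_drive hf x).comp hZ), ?_⟩
  intro x B hB
  have hj : Measurable fun p : E × (ℕ → Z) => drive f p.1 p.2 :=
    measurable_from_prod_countable_right (measurable_drive hf)
  have hD : MeasurableSet {p : Z × (ℕ → Z) | drive f (f x p.1) p.2 ∈ B} :=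
    (hj.comp (((hf x).comp measurable_fst).prodMk measurable_snd)) hB
  -- The first input is independent of the later ones, which have the law of the whole sequence;
  -- Fubini then integrates over the first input.
  calc P {ω | (fun t => drive f x (fun s => z s ω) (t + 1)) ∈ B}
      = P.map (fun ω => (z 0 ω, fun s => z (s + 1) ω))
          {p : Z × (ℕ → Z) | drive f (f x p.1) p.2 ∈ B} := by
        rw [Measure.map_apply ((hz 0).prodMk hT) hD]
        simp only [drive_succ']
        rfl
    _ = ∫⁻ v, P.map (fun ω s => z s ω) {ζ | drive f (f x v) ζ ∈ B} ∂(P.map (z 0)) := by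
        rw [(indepFun_head_tail hz hind).map_prod_eq_prod_map_map (hz 0).aemeasurable
          hT.aemeasurable, map_tail_eq hz hind hid, Measure.prod_apply hD]
        rfl
    _ = ∫⁻ ω, P.map (fun ω s => z s ω) {ζ | drive f (f x (z 0 ω)) ζ ∈ B} ∂P :=
        lintegral_map (measurable_measure_prodMk_left hD) (hz 0)
    _ = _ := by
        refine lintegral_congr fun ω => ?_
        exact Measure.map_apply hZ (measurable_drive hf _ hB)

end Drive

/-! ### Finitely many visits imply transience. -/

section Transience

variable {Ω E : Type*} [MeasurableSpace Ω] [MeasurableSpace E] [Countable E]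
  [MeasurableSingletonClass E]

omit [Countable E] in
/-- A chain that almost surely visits each initial state finitely often is transient. -/
theorem isTransientChain_of_finite_visits {P : Measure Ω} [IsProbabilityMeasure P]
    {X : E → ℕ → Ω → E} (hX : IsMarkovFamily P X)
    (hfin : ∀ x, ∀ᵐ ω ∂P, {t | X x t ω = x}.Finite) : IsTransientChain P X := by
  intro x
  by_contra hret
  have hret1 : ∀ᵐ ω ∂P, ∃ t, 1 ≤ t ∧ X x t ω = x := by
    have hm : MeasurableSet {ω | ∃ t, 1 ≤ t ∧ X x t ω = x} := by
      simp only [Set.ofPred_exists, Set.ofPred_and]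
      exact MeasurableSet.iUnion fun t => (MeasurableSet.const _).inter
        (hX.measurable x t (measurableSet_singleton x))
    have h1 : P {ω | ∃ t, 1 ≤ t ∧ X x t ω = x} = 1 := le_antisymm prob_le_one (not_lt.1 hret)
    exact (prob_compl_eq_zero_iff hm).2 h1
  -- Time `t` is almost surely not the last visit to `x`, from any start `y`. The first-step
  -- property reduces this to `t = 0`, where it is the sure return to `x`.
  have key : ∀ (t : ℕ) (y : E),
      P {ω | X y t ω = x ∧ ∀ s, X y (t + s + 1) ω ≠ x} = 0 := by
    intro t
    induction t with
    | zero =>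
      intro y
      by_cases hy : y = x
      · subst hy
        refine measure_mono_null ?_ hret1
        rintro ω ⟨-, h⟩ ⟨t, ht, hty⟩
        refine h (t - 1) ?_
        rwa [Nat.zero_add, Nat.sub_add_cancel ht]
      · simp [hX.start, hy]
    | succ t ih =>
      intro y
      have hB : MeasurableSet {w : ℕ → E | w t = x ∧ ∀ s, w (t + s + 1) ≠ x} := by
        simp only [Set.ofPred_and, Set.ofPred_forall]
        exact ((measurable_pi_apply (X := fun _ : ℕ => E) t) (measurableSet_singleton x)).inter
          (MeasurableSet.iInter fun s => (measurable_pi_apply (X := fun _ : ℕ => E) (t + s + 1))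
            (measurableSet_singleton x).compl)
      have h := hX.first_step y _ hB
      simp only [Set.mem_ofPred_eq, ih, lintegral_zero] at h
      rw [← h]
      congr 1
      ext ω
      simp only [Set.mem_ofPred_eq]
      refine and_congr Iff.rfl (forall_congr' fun s => ?_)
      rw [show t + 1 + s + 1 = t + s + 1 + 1 by ring]
  have hae : ∀ᵐ ω ∂P, ∀ t, ¬ (X x t ω = x ∧ ∀ s, X x (t + s + 1) ω ≠ x) := by
    rw [ae_all_iff]
    intro t
    rw [ae_iff]
    simpa only [not_not] using key t x
  obtain ⟨ω, h1, h2⟩ := (hae.and (hfin x)).exists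
  obtain ⟨t, ht, hmax⟩ := Set.exists_max_image _ (fun t : ℕ => t) h2 ⟨0, hX.start x ω⟩
  refine h1 t ⟨ht, fun s hs => ?_⟩
  have := hmax _ hs
  omega

end Transience
-- The switched network: separation, MaxWeight and quadratic drift.
section Network

variable {q : ℕ} {Ω U : Type*} [MeasurableSpace Ω] [MeasurableSpace U]

theorem IsScheduleSet.finite {S : Set (Fin q → ℕ)} (hS : IsScheduleSet S) : S.Finite := by
  obtain ⟨m, hm⟩ := hS.bounded
  exact (Set.finite_Icc (0 : Fin q → ℕ) fun _ => m).subset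
    fun σ hσ => ⟨fun j => Nat.zero_le _, fun j => hm σ hσ j⟩

theorem IsInput.isMarkovFamily_queue {P : Measure Ω} [IsProbabilityMeasure P]
    {a : ℕ → Ω → Fin q → ℕ} {u : ℕ → Ω → U} {abar : Fin q → ℝ} (hin : IsInput P a u abar)
    {S : Set (Fin q → ℕ)} {δ : (Fin q → ℕ) → U → Fin q → ℕ} (hδ : IsMarkovPolicy S δ) :
    IsMarkovFamily P (queue δ a u) := by
  have h := isMarkovFamily_drive (P := P)
    (f := fun (x : Fin q → ℕ) (v : (Fin q → ℕ) × U) => x + v.1 - δ x v.2)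
    (z := fun t ω => (a t ω, u t ω))
    (fun x => (measurable_of_countable fun p : (Fin q → ℕ) × (Fin q → ℕ) => x + p.1 - p.2).comp
      (measurable_fst.prodMk ((hδ.measurable x).comp measurable_snd)))
    (fun t => (hin.measurable_arrival t).prodMk (hin.measurable_random t)) hin.indep hin.ident
  convert h using 1
  funext x t ω
  induction t with
  | zero => rfl
  | succ t ih => rw [queue, ih, drive]

omit [MeasurableSpace Ω] in
theorem IsMarkovPolicy.isQueueProcess {S : Set (Fin q → ℕ)} {δ : (Fin q → ℕ) → U → Fin q → ℕ}
    (hδ : IsMarkovPolicy S δ) (a : ℕ → Ω → Fin q → ℕ) (u : ℕ → Ω → U) (x : Fin q → ℕ) :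
    IsQueueProcess S a (fun t ω => δ (queue δ a u x t ω) (u t ω)) (queue δ a u x) := by
  refine ⟨fun t ω => hδ.schedule _ _, fun t ω => ?_⟩
  funext j
  have : δ (queue δ a u x t ω) (u t ω) j ≤ queue δ a u x t ω j := hδ.le_queue _ _ j
  simp only [queue, Pi.add_apply, Pi.sub_apply]
  omega

theorem IsInput.integrable_arrival {P : Measure Ω} [IsProbabilityMeasure P]
    {a : ℕ → Ω → Fin q → ℕ} {u : ℕ → Ω → U} {abar : Fin q → ℝ} (hin : IsInput P a u abar)
    (t : ℕ) (j : Fin q) : Integrable (fun ω => (a t ω j : ℝ)) P := by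
  obtain ⟨m, hm⟩ := hin.bounded
  refine Integrable.of_bound (C := m) ?_ ?_
  · exact ((measurable_of_countable fun σ : Fin q → ℕ => (σ j : ℝ)).comp
      (hin.measurable_arrival t)).aestronglyMeasurable
  · filter_upwards [hm t] with ω hω
    simpa using hω j

/-- The strong law of large numbers for the arrivals. -/
theorem IsInput.tendsto_average {P : Measure Ω} [IsProbabilityMeasure P]
    {a : ℕ → Ω → Fin q → ℕ} {u : ℕ → Ω → U} {abar : Fin q → ℝ} (hin : IsInput P a u abar) :
    ∀ᵐ ω ∂P, Filter.Tendsto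
      (fun n : ℕ => (n : ℝ)⁻¹ • ∑ i ∈ Finset.range n, fun j => (a i ω j : ℝ))
      Filter.atTop (nhds abar) := by
  have hg : Measurable fun p : (Fin q → ℕ) × U => fun j => (p.1 j : ℝ) :=
    (measurable_of_countable fun σ : Fin q → ℕ => fun j => (σ j : ℝ)).comp measurable_fst
  have hint : Integrable (fun ω => fun j => (a 0 ω j : ℝ)) P :=
    Integrable.of_eval fun j => hin.integrable_arrival 0 j
  have h := strong_law_ae (μ := P) (fun t ω => fun j => (a t ω j : ℝ)) hint
    (fun i j hij => (hin.indep.indepFun hij).comp hg hg)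
    (fun t => (hin.ident t).comp hg)
  have hmean : ∫ ω, (fun j => (a 0 ω j : ℝ)) ∂P = abar := by
    funext j
    rw [eval_integral fun j => hin.integrable_arrival 0 j, hin.mean 0 j]
  rwa [hmean] at h

/-- Outside the stability region, every queue process visits each state finitely often. -/
theorem IsQueueProcess.finite_visits {P : Measure Ω} [IsProbabilityMeasure P]
    {a : ℕ → Ω → Fin q → ℕ} {u : ℕ → Ω → U} {abar : Fin q → ℝ} (hin : IsInput P a u abar)
    {S : Set (Fin q → ℕ)} (hS : IsScheduleSet S) (habar : abar ∉ stabilityRegion S)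
    {d Q : ℕ → Ω → Fin q → ℕ} (hQ : IsQueueProcess S a d Q) :
    ∀ᵐ ω ∂P, ∀ x : Fin q → ℕ, {t : ℕ | Q t ω = x}.Finite := by
  obtain ⟨φ, c, hφ, hc⟩ := geometric_hahn_banach_closed_point (convex_convexHull ℝ _)
    ((hS.finite.image _).isClosed_convexHull ℝ) habar
  obtain ⟨c', hcc', hc'⟩ := exists_between hc
  filter_upwards [hin.tendsto_average] with ω hω x
  set r : (Fin q → ℕ) → Fin q → ℝ := fun σ j => (σ j : ℝ) with hr
  have hstep : ∀ n, φ (r (Q 0 ω)) + φ (∑ i ∈ Finset.range n, r (a i ω)) - n * c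
      ≤ φ (r (Q n ω)) := by
    intro n
    induction n with
    | zero => simp
    | succ n ih =>
      have h1 : r (Q (n + 1) ω) + r (d n ω) = r (Q n ω) + r (a n ω) := by
        funext j
        have := congrFun (hQ.dynamics n ω) j
        simp only [hr, Pi.add_apply] at this ⊢
        exact_mod_cast this
      have h2 := congrArg φ h1
      rw [map_add, map_add] at h2
      have h3 : φ (r (d n ω)) < c := hφ _ (subset_convexHull ℝ _ ⟨_, hQ.schedule n ω, rfl⟩)
      rw [Finset.sum_range_succ, map_add]
      push_cast
      linarith
  have hev : ∀ᶠ n : ℕ in Filter.atTop, n * c' ≤ φ (∑ i ∈ Finset.range n, r (a i ω)) := by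
    filter_upwards [((φ.continuous.tendsto _).comp hω).eventually (lt_mem_nhds hc'),
      Filter.eventually_gt_atTop 0] with n hn hn0
    have hn0' : (0 : ℝ) < n := by exact_mod_cast hn0
    simp only [Function.comp, map_smul, smul_eq_mul] at hn
    rw [lt_inv_mul_iff₀ hn0'] at hn
    exact hn.le
  have hlarge : ∀ᶠ n : ℕ in Filter.atTop, (φ (r x) - φ (r (Q 0 ω))) / (c' - c) < n :=
    (tendsto_natCast_atTop_atTop (R := ℝ)).eventually_gt_atTop _
  have hne : ∀ᶠ n in Filter.atTop, Q n ω ≠ x := by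
    filter_upwards [hev, hlarge] with n h1 h2 hx
    have h3 := hstep n
    rw [hx] at h3
    rw [div_lt_iff₀ (sub_pos.2 hcc')] at h2
    nlinarith
  rw [← Nat.cofinite_eq_atTop, Filter.eventually_cofinite] at hne
  simpa using hne

/-- The weight of a MaxWeight schedule is, up to a constant, the support function of the
stability region. -/
theorem IsMaxWeight.sum_mul_le {S : Set (Fin q → ℕ)} (hS : IsScheduleSet S) {m : ℕ}
    (hm : ∀ σ ∈ S, ∀ j, σ j ≤ m) {δ : (Fin q → ℕ) → U → Fin q → ℕ} (hδ : IsMaxWeight S δ)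
    (x : Fin q → ℕ) (v : U) {w : Fin q → ℝ} (hw : w ∈ stabilityRegion S) :
    ∑ j, (x j : ℝ) * w j ≤ ∑ j, (x j : ℝ) * δ x v j + q * (m : ℝ) ^ 2 := by
  -- The bound is linear in `w`, so it suffices to check it at the schedules.
  have hconv : Convex ℝ {w : Fin q → ℝ |
      ∑ j, (x j : ℝ) * w j ≤ ∑ j, (x j : ℝ) * δ x v j + q * (m : ℝ) ^ 2} := by
    refine convex_halfSpace_le ⟨fun w w' => ?_, fun c w => ?_⟩ _
    · simp [mul_add, Finset.sum_add_distrib]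
    · simp only [Pi.smul_apply, smul_eq_mul, Finset.mul_sum]
      exact Finset.sum_congr rfl fun j _ => by ring
  refine convexHull_min ?_ hconv hw
  rintro _ ⟨σ, hσ, rfl⟩
  -- A schedule may exceed the queue, so the comparison is with `σ ⊓ x`. Truncation matters only
  -- where `x j ≤ σ j ≤ m`, and costs at most `m ^ 2` per queue.
  have h1 := hδ.maximal x v (σ ⊓ x) (hS.monotone σ hσ _ inf_le_left) inf_le_right
  have h2 : ∀ j, x j * σ j ≤ x j * (σ ⊓ x) j + m ^ 2 := by
    intro j
    rw [Pi.inf_apply]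
    rcases le_total (σ j) (x j) with h | h
    · rw [inf_eq_left.2 h]
      exact Nat.le_add_right _ _
    · have := hm σ hσ j
      calc x j * σ j ≤ m * m := Nat.mul_le_mul (h.trans this) this
        _ ≤ _ := by rw [pow_two]; exact Nat.le_add_left _ _
  have h3 : ∑ j, x j * σ j ≤ ∑ j, x j * δ x v j + q * m ^ 2 := by
    calc ∑ j, x j * σ j ≤ ∑ j, (x j * (σ ⊓ x) j + m ^ 2) := Finset.sum_le_sum fun j _ => h2 j
      _ = ∑ j, x j * (σ ⊓ x) j + q * m ^ 2 := by simp [Finset.sum_add_distrib]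
      _ ≤ _ := Nat.add_le_add_right h1 _
  change ∑ j, (x j : ℝ) * (σ j : ℝ) ≤ _
  exact_mod_cast h3

/-- The same slack in every coordinate turns into a drift proportional to the total queue size. -/
theorem exists_add_const_mem_of_mem_interior {C : Set (Fin q → ℝ)} {w : Fin q → ℝ}
    (hw : w ∈ interior C) : ∃ ε > 0, (fun j => w j + ε) ∈ C := by
  obtain ⟨r, hr, hball⟩ := Metric.mem_nhds_iff.1 (mem_interior_iff_mem_nhds.1 hw)
  refine ⟨r / 2, by positivity, hball ?_⟩
  rw [Metric.mem_ball, dist_pi_lt_iff hr]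
  intro j
  rw [Real.dist_eq, add_sub_cancel_left, abs_of_pos (by positivity)]
  linarith

/-- One step of a MaxWeight policy changes the quadratic Lyapunov function by at most a mean zero
variable, a negative multiple of the total queue size and a constant. -/
theorem IsMaxWeight.sum_sq_step_le {S : Set (Fin q → ℕ)} (hS : IsScheduleSet S) {m : ℕ}
    (hm : ∀ σ ∈ S, ∀ j, σ j ≤ m) {δ : (Fin q → ℕ) → U → Fin q → ℕ} (hδ : IsMaxWeight S δ)
    {abar : Fin q → ℝ} {ε : ℝ} (hε : (fun j => abar j + ε) ∈ stabilityRegion S)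
    (x : Fin q → ℕ) (v : U) {α : Fin q → ℕ} {k : ℕ} (hα : ∀ j, α j ≤ k) :
    ∑ j, (((x + α - δ x v) j : ℕ) : ℝ) ^ 2 ≤ ∑ j, (x j : ℝ) ^ 2 - 2 * ε * ∑ j, (x j : ℝ)
      + q * ((k : ℝ) ^ 2 + 3 * (m : ℝ) ^ 2) + ∑ j, 2 * (x j : ℝ) * (α j - abar j) := by
  have h1 := hδ.sum_mul_le hS hm x v hε
  -- The square is expanded and the cross term `-2 * α j * δ x v j` dropped. Its `m ^ 2`, with twice
  -- the error in `h1`, gives the final `3 * m ^ 2`.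
  have h2 : ∀ j, (((x + α - δ x v) j : ℕ) : ℝ) ^ 2 ≤ (x j : ℝ) ^ 2
      + 2 * ((x j : ℝ) * (α j - δ x v j)) + ((k : ℝ) ^ 2 + (m : ℝ) ^ 2) := by
    intro j
    have hle : δ x v j ≤ x j := hδ.le_queue x v j
    have hcast : (((x + α - δ x v) j : ℕ) : ℝ) = x j + α j - δ x v j := by
      rw [Pi.sub_apply, Pi.add_apply, Nat.cast_sub (by omega), Nat.cast_add]
    have ha : (α j : ℝ) ≤ k := by exact_mod_cast hα j
    have hd : (δ x v j : ℝ) ≤ m := by exact_mod_cast hm _ (hδ.schedule x v) j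
    have ha2 : (α j : ℝ) ^ 2 ≤ (k : ℝ) ^ 2 := by gcongr
    have hd2 : (δ x v j : ℝ) ^ 2 ≤ (m : ℝ) ^ 2 := by gcongr
    have had : 0 ≤ (α j : ℝ) * δ x v j := by positivity
    rw [hcast]
    nlinarith
  have h3 := Finset.sum_le_sum fun j (_ : j ∈ Finset.univ) => h2 j
  simp only [Finset.sum_add_distrib, mul_add, mul_sub, Finset.sum_sub_distrib, Finset.sum_const,
    Finset.card_univ, Fintype.card_fin, nsmul_eq_mul, ← Finset.mul_sum, ← Finset.sum_mul,
    mul_assoc] at h1 h3 ⊢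
  linarith

theorem IsMaxWeight.isPositiveRecurrentChain {P : Measure Ω} [IsProbabilityMeasure P]
    {a : ℕ → Ω → Fin q → ℕ} {u : ℕ → Ω → U} {abar : Fin q → ℝ} (hin : IsInput P a u abar)
    {S : Set (Fin q → ℕ)} (hS : IsScheduleSet S) (habar : abar ∈ interior (stabilityRegion S))
    {δ : (Fin q → ℕ) → U → Fin q → ℕ} (hδ : IsMaxWeight S δ) :
    IsPositiveRecurrentChain P (queue δ a u) := by
  obtain ⟨m, hm⟩ := hS.bounded
  obtain ⟨k, hk⟩ := hin.bounded
  obtain ⟨ε, hε0, hε⟩ := exists_add_const_mem_of_mem_interior habar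
  set K : ℝ := q * ((k : ℝ) ^ 2 + 3 * (m : ℝ) ^ 2) with hK
  have hK0 : 0 ≤ K := by positivity
  -- Off `F` the negative drift exceeds `K + 1`, so the mean decrease is more than `1`; on `F` an
  -- allowance of `b = K + 1` suffices.
  set F : Set (Fin q → ℕ) := {x | 2 * ε * ∑ j, (x j : ℝ) ≤ K + 1} with hFdef
  have hF : F.Finite := by
    refine (Set.finite_Icc (0 : Fin q → ℕ) fun _ => ⌊(K + 1) / (2 * ε)⌋₊).subset
      fun x hx => ⟨fun j => Nat.zero_le _, fun j => Nat.le_floor ?_⟩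
    rw [le_div_iff₀ (by positivity), mul_comm]
    refine le_trans ?_ hx
    gcongr
    exact Finset.single_le_sum (f := fun j => (x j : ℝ)) (fun i _ => Nat.cast_nonneg _)
      (Finset.mem_univ j)
  refine isPositiveRecurrentChain_of_drift (hin.isMarkovFamily_queue hδ.toIsMarkovPolicy) hF
    (V := fun x => ENNReal.ofReal (∑ j, (x j : ℝ) ^ 2)) (b := ENNReal.ofReal (K + 1))
    (fun x => ENNReal.ofReal_ne_top) ENNReal.ofReal_ne_top fun x => ?_
  set R : ℝ := ∑ j, (x j : ℝ) ^ 2 - 2 * ε * ∑ j, (x j : ℝ) + K with hR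
  have hbound : ∀ᵐ ω ∂P, ∑ j, (queue δ a u x 1 ω j : ℝ) ^ 2 ≤
      R + ∑ j, 2 * (x j : ℝ) * (a 0 ω j - abar j) := by
    filter_upwards [hk 0] with ω hω
    exact hδ.sum_sq_step_le hS hm hε x (u 0 ω) hω
  have hnonneg : 0 ≤ᵐ[P] fun ω => R + ∑ j, 2 * (x j : ℝ) * (a 0 ω j - abar j) := by
    filter_upwards [hbound] with ω hω
    exact le_trans (by positivity) hω
  have hterm : ∀ j ∈ Finset.univ,
      Integrable (fun ω => 2 * (x j : ℝ) * (a 0 ω j - abar j)) P := fun j _ =>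
    ((hin.integrable_arrival 0 j).sub (integrable_const _)).const_mul _
  have hintegrable : Integrable
      (fun ω => R + ∑ j, 2 * (x j : ℝ) * (a 0 ω j - abar j)) P :=
    (integrable_const _).add (integrable_finsetSum _ hterm)
  have hint : ∫ ω, (R + ∑ j, 2 * (x j : ℝ) * (a 0 ω j - abar j)) ∂P = R := by
    rw [integral_add (integrable_const _) (integrable_finsetSum _ hterm),
      integral_finsetSum _ hterm]
    simp [integral_const_mul, integral_sub (hin.integrable_arrival 0 _) (integrable_const _),
      hin.mean 0]
  -- `ENNReal.ofReal` truncates at zero, so `R + 1` can be split only once `R` is known to be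
  -- nonnegative; it is the mean of an upper bound for a sum of squares.
  have hR0 : 0 ≤ R := hint ▸ integral_nonneg_of_ae hnonneg
  have hle : ∫⁻ ω, ENNReal.ofReal (∑ j, (queue δ a u x 1 ω j : ℝ) ^ 2) ∂P ≤ ENNReal.ofReal R := by
    rw [← hint, ofReal_integral_eq_lintegral_ofReal hintegrable hnonneg]
    exact lintegral_mono_ae (hbound.mono fun ω hω => ENNReal.ofReal_le_ofReal hω)
  refine (add_le_add_left hle 1).trans ?_
  rw [← ENNReal.ofReal_one, ← ENNReal.ofReal_add hR0 zero_le_one]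
  have hs0 : 0 ≤ ∑ j, (x j : ℝ) := by positivity
  by_cases hx : x ∈ F
  · rw [Set.indicator_of_mem hx, ← ENNReal.ofReal_add (by positivity) (by positivity)]
    refine ENNReal.ofReal_le_ofReal ?_
    have : 0 ≤ 2 * ε * ∑ j, (x j : ℝ) := by positivity
    linarith
  · rw [Set.indicator_of_notMem hx, add_zero]
    refine ENNReal.ofReal_le_ofReal ?_
    have : K + 1 < 2 * ε * ∑ j, (x j : ℝ) := not_le.1 hx
    linarith

end Network
end SwitchedQueue

theorem mainTheorem5 {q : ℕ} (S : Set (Fin q → ℕ)) (hS : SwitchedQueue.IsScheduleSet S)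
    {Ω U : Type*} [MeasurableSpace Ω] [MeasurableSpace U]
    (P : Measure Ω) [IsProbabilityMeasure P]
    (a : ℕ → Ω → Fin q → ℕ) (u : ℕ → Ω → U) (abar : Fin q → ℝ)
    (hin : SwitchedQueue.IsInput P a u abar) :
    (abar ∉ SwitchedQueue.stabilityRegion S →
      (∀ d Q : ℕ → Ω → Fin q → ℕ, SwitchedQueue.IsQueueProcess S a d Q →
        ∀ᵐ ω ∂P, ∀ x : Fin q → ℕ, {t : ℕ | Q t ω = x}.Finite) ∧
      (∀ δ : (Fin q → ℕ) → U → Fin q → ℕ, SwitchedQueue.IsMarkovPolicy S δ →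
        SwitchedQueue.IsTransientChain P (SwitchedQueue.queue δ a u))) ∧
    (abar ∈ interior (SwitchedQueue.stabilityRegion S) →
      ∀ δ : (Fin q → ℕ) → U → Fin q → ℕ, SwitchedQueue.IsMaxWeight S δ →
        SwitchedQueue.IsPositiveRecurrentChain P (SwitchedQueue.queue δ a u)) := by
  refine ⟨fun habar => ⟨fun d Q hQ => hQ.finite_visits hin hS habar, fun δ hδ => ?_⟩,
    fun habar δ hδ => hδ.isPositiveRecurrentChain hin hS habar⟩
  refine SwitchedQueue.isTransientChain_of_finite_visits (hin.isMarkovFamily_queue hδ) fun x => ?_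
  filter_upwards [(hδ.isQueueProcess a u x).finite_visits hin hS habar] with ω hω
  exact hω x
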